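/- Let $(X,d)$ be a geodesic metric space, i.e. a metric space in which any two points $x,y$ are joined by a geodesic segment (the image of an isometric embedding of $[0,d(x,y)]$ starting at $x$ and ending at $y$). Let $B(x,r)=\{z\in X : d(x,z)\le r\}$, $r\ge 0$, denote the closed balls of $X$. Recall that $X$ is an $\mathbb R$-tree if any two points $x,y$ are joined by a unique geodesic segment $[x,y]$, and $[y,x]\cap[x,z]=\{x\}$ implies $[y,x]\cup[x,z]=[y,z]$. A subset $S\subseteq X$ has eccentricity at most $\delta\ge 0$ if $S=\emptyset$ or there are $R\ge 0$ and $c,c'\in X$ with $B(c,R)\subseteq S\subseteq B(c',R+\delta)$; the eccentricity of $S$ is the infimum of all such $\delta$ ($\infty$ if there is none). Then the following conditions are equivalent: 1. $X$ is an $\mathbb R$-tree; 2. for all $x,y\in X$ and $s,t\ge 0$, the intersection $B(x,s)\cap B(y,t)$ is either empty or a ball $B(c,r)$ with $c\in X$, $r\ge 0$; 3. for all $x,y\in X$ and $s,t\ge 0$, the intersection $B(x,s)\cap B(y,t)$ has eccentricity at most $0$ (with $\delta=0$ attained in the definition above); 4. for all $x,y\in X$ and $s,t\ge 0$, the eccentricity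 of $B(x,s)\cap B(y,t)$ is equal to $0$. -/

import Mathlib

open scoped NNReal ENNReal

/-- `S` is (the image of) a geodesic segment from `x` to `y`: the image of an isometric
embedding of the interval `[0, dist x y]` that starts at `x` and ends at `y`. -/
def IsGeodesicSegment {X : Type*} [MetricSpace X] (S : Set X) (x y : X) : Prop :=
  ∃ γ : ℝ → X, γ 0 = x ∧ γ (dist x y) = y ∧
    (∀ s ∈ Set.Icc 0 (dist x y), ∀ t ∈ Set.Icc 0 (dist x y), dist (γ s) (γ t) = |s - t|) ∧
    γ '' Set.Icc 0 (dist x y) = S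

/-- A geodesic metric space: any two points are joined by a geodesic segment. -/
def IsGeodesicSpace (X : Type*) [MetricSpace X] : Prop :=
  ∀ x y : X, ∃ S : Set X, IsGeodesicSegment S x y

/-- An `ℝ`-tree: any two points are joined by a unique geodesic segment, and if two geodesic
segments `[y, x]` and `[x, z]` meet only in their common endpoint `x`, then their union is the
geodesic segment `[y, z]`. -/
structure IsRTree (X : Type*) [MetricSpace X] : Prop where
  existsUnique_segment : ∀ x y : X, ∃! S : Set X, IsGeodesicSegment S x y
  union_segment : ∀ (x y z : X) (S T : Set X), IsGeodesicSegment S y x → IsGeodesicSegment T x z →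
    S ∩ T = {x} → IsGeodesicSegment (S ∪ T) y z

/-- `S` is a closed metric ball of some centre and some radius `r ≥ 0`. -/
def IsBall {X : Type*} [MetricSpace X] (S : Set X) : Prop :=
  ∃ (c : X) (r : ℝ), 0 ≤ r ∧ S = Metric.closedBall c r

/-- `S` has eccentricity at most `δ`: it lies between two closed balls, possibly with different
centres, of radii `R` and `R + δ` for some `R ≥ 0`. The empty set has eccentricity `0`. -/
def HasEccentricityLE {X : Type*} [MetricSpace X] (S : Set X) (δ : ℝ≥0) : Prop :=
  S = ∅ ∨ ∃ (R : ℝ) (c c' : X), 0 ≤ R ∧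
    Metric.closedBall c R ⊆ S ∧ S ⊆ Metric.closedBall c' (R + δ)

/-- The eccentricity of `S`: the infimum of its eccentricity bounds (`∞` if there is none). -/
noncomputable def eccentricity {X : Type*} [MetricSpace X] (S : Set X) : ℝ≥0∞ :=
  ⨅ (δ : ℝ≥0) (_ : HasEccentricityLE S δ), (δ : ℝ≥0∞)

/-! In a tree, two balls that overlap without containing each other meet in a ball centred on the
segment joining their centres; passing from balls to eccentricity is immediate. Conversely,
eccentricity 0 forces B(x,s) ∩ B(y,t) to have diameter at most 2(s + t - d(x,y)), which is
`HasThinBallIntersections`. For two geodesics from a common point, this makes a positive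
`pathDefect` grow geometrically over steps proportional to itself. The length left after the
geodesics differ is therefore at most a constant times the distance of their ends (`eq_of_dist_lt`).
Equal ends give uniqueness. Sliding the end along [y,z] shows that the point of [y,z] nearest to x
lies on both [x,y] and [x,z]; if these meet only in x, that point is x, so x lies on [y,z]. -/

/-- `γ` restricted to `[0, L]` is an isometric embedding. -/
def IsometricOnIcc {X : Type*} [MetricSpace X] (γ : ℝ → X) (L : ℝ) : Prop :=
  ∀ s ∈ Set.Icc 0 L, ∀ t ∈ Set.Icc 0 L, dist (γ s) (γ t) = |s - t|

/-- Points lying in two common balls are close to each other if the balls barely overlap. -/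
def HasThinBallIntersections (X : Type*) [MetricSpace X] : Prop :=
  ∀ (x y z w : X) (s t : ℝ), dist x z ≤ s → dist x w ≤ s → dist y z ≤ t → dist y w ≤ t →
    dist z w ≤ 2 * (s + t - dist x y)

theorem eq_of_locally_eq {Y : Type*} {F : ℝ → Y} {L η : ℝ} (hη : 0 < η)
    (h : ∀ s ∈ Set.Icc 0 L, ∀ t ∈ Set.Icc 0 L, |s - t| < η → F s = F t) :
    ∀ t ∈ Set.Icc 0 L, F t = F 0 := by
  intro t ht
  obtain ⟨n, hn⟩ := exists_nat_ge (t / (η / 2))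
  rw [div_le_iff₀ (by positivity)] at hn
  induction n generalizing t with
  | zero =>
    simp only [Nat.cast_zero, zero_mul] at hn
    rw [le_antisymm hn ht.1]
  | succ n ih =>
    push_cast at hn
    have hmem : max 0 (t - η / 2) ∈ Set.Icc 0 L :=
      ⟨le_max_left _ _, max_le (ht.1.trans ht.2) (by linarith [ht.2])⟩
    rw [← ih _ hmem (max_le (by positivity) (by linarith))]
    refine h t ht _ hmem ?_
    rw [abs_lt]
    constructor
    · have := max_le ht.1 (by linarith : t - η / 2 ≤ t)
      linarith
    · have := le_max_right 0 (t - η / 2)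
      linarith

/-! ### Isometric paths and geodesic segments -/

section Geodesics

variable {X : Type*} [MetricSpace X]

namespace IsometricOnIcc

theorem mono {γ : ℝ → X} {L M : ℝ} (h : IsometricOnIcc γ L) (hM : M ≤ L) :
    IsometricOnIcc γ M := fun s hs t ht =>
  h s ⟨hs.1, hs.2.trans hM⟩ t ⟨ht.1, ht.2.trans hM⟩

theorem dist_of_le {γ : ℝ → X} {L s t : ℝ} (h : IsometricOnIcc γ L) (hs : 0 ≤ s) (hst : s ≤ t)
    (ht : t ≤ L) : dist (γ s) (γ t) = t - s := by
  rw [h s ⟨hs, hst.trans ht⟩ t ⟨hs.trans hst, ht⟩, abs_sub_comm, abs_of_nonneg (by linarith)]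

theorem reverse {γ : ℝ → X} {L : ℝ} (h : IsometricOnIcc γ L) :
    IsometricOnIcc (fun s => γ (L - s)) L := by
  intro s hs t ht
  have := h (L - s) ⟨by linarith [hs.2], by linarith [hs.1]⟩ (L - t)
    ⟨by linarith [ht.2], by linarith [ht.1]⟩
  rw [this, abs_sub_comm]
  congr 1
  ring

theorem continuousOn {γ : ℝ → X} {L : ℝ} (h : IsometricOnIcc γ L) :
    ContinuousOn γ (Set.Icc 0 L) := by
  have : LipschitzOnWith 1 γ (Set.Icc 0 L) := LipschitzOnWith.of_dist_le_mul fun s hs t ht => by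
    rw [h s hs t ht, Real.dist_eq]
    simp
  exact this.continuousOn

end IsometricOnIcc

/-- Concatenation of isometric paths whose lengths add up to the distance of the end points. -/
theorem isometricOnIcc_concat {α β : ℝ → X} {A B : ℝ} (hα : IsometricOnIcc α A)
    (hβ : IsometricOnIcc β B) (hαβ : α A = β 0)
    (hd : dist (α 0) (β B) = A + B) :
    IsometricOnIcc (fun s => if s ≤ A then α s else β (s - A)) (A + B) := by
  have cross : ∀ s t, 0 ≤ s → s ≤ A → A ≤ t → t ≤ A + B → dist (α s) (β (t - A)) = t - s := by
    intro s t hs hsA hAt ht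
    have h1 := hα.dist_of_le le_rfl hs hsA
    have h2 := hα.dist_of_le hs hsA le_rfl
    have h3 := hβ.dist_of_le le_rfl (sub_nonneg.2 hAt) (by linarith)
    have h4 := hβ.dist_of_le (sub_nonneg.2 hAt) (by linarith : t - A ≤ B) le_rfl
    have h5 := dist_triangle4 (α 0) (α s) (β (t - A)) (β B)
    have h6 := dist_triangle (α s) (α A) (β (t - A))
    rw [hαβ] at h2 h6
    linarith
  intro s hs t ht
  by_cases h1 : s ≤ A <;> by_cases h2 : t ≤ A <;> simp only [h1, h2, if_true, if_false]
  · exact hα s ⟨hs.1, h1⟩ t ⟨ht.1, h2⟩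
  · rw [cross s t hs.1 h1 (by linarith) ht.2, abs_sub_comm, abs_of_nonneg (by linarith)]
  · rw [dist_comm, cross t s ht.1 h2 (by linarith) hs.2, abs_of_nonneg (by linarith)]
  · rw [hβ (s - A) ⟨by linarith, by linarith [hs.2]⟩ (t - A) ⟨by linarith, by linarith [ht.2]⟩]
    congr 1
    ring

theorem IsGeodesicSegment.symm {S : Set X} {x y : X} (h : IsGeodesicSegment S x y) :
    IsGeodesicSegment S y x := by
  obtain ⟨γ, h0, h1, hγ, rfl⟩ := h
  rw [IsGeodesicSegment, dist_comm y x]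
  refine ⟨fun s => γ (dist x y - s), by simpa using h1, by simpa using h0,
    IsometricOnIcc.reverse hγ, ?_⟩
  ext p
  constructor
  · rintro ⟨s, hs, rfl⟩
    exact ⟨dist x y - s, ⟨by linarith [hs.2], by linarith [hs.1]⟩, rfl⟩
  · rintro ⟨s, hs, rfl⟩
    exact ⟨dist x y - s, ⟨by linarith [hs.2], by linarith [hs.1]⟩, by simp⟩

theorem IsGeodesicSegment.dist_add_dist {S : Set X} {x y p : X} (h : IsGeodesicSegment S x y)
    (hp : p ∈ S) : dist x p + dist p y = dist x y := by
  obtain ⟨γ, h0, h1, hγ, rfl⟩ := h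
  obtain ⟨s, hs, rfl⟩ := hp
  have e1 := IsometricOnIcc.dist_of_le hγ le_rfl hs.1 hs.2
  have e2 := IsometricOnIcc.dist_of_le hγ hs.1 hs.2 le_rfl
  rw [h0] at e1
  rw [h1] at e2
  linarith

/-- Two geodesic segments whose lengths add up to the distance of the end points form a
geodesic segment. -/
theorem IsGeodesicSegment.union {S T : Set X} {x y z : X} (hS : IsGeodesicSegment S y x)
    (hT : IsGeodesicSegment T x z) (hd : dist y z = dist y x + dist x z) :
    IsGeodesicSegment (S ∪ T) y z := by
  obtain ⟨α, hα0, hα1, hα, rfl⟩ := hS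
  obtain ⟨β, hβ0, hβ1, hβ, rfl⟩ := hT
  have hA : 0 ≤ dist y x := dist_nonneg
  have hB : 0 ≤ dist x z := dist_nonneg
  rw [IsGeodesicSegment, hd]
  refine ⟨fun s => if s ≤ dist y x then α s else β (s - dist y x), ?_, ?_,
    isometricOnIcc_concat hα hβ (hα1.trans hβ0.symm) (by rw [hα0, hβ1, hd]), ?_⟩
  · simp [hα0]
  · by_cases h : dist x z = 0
    · have := dist_eq_zero.1 h
      simp [← this, hα1]
    · have : ¬ dist y x + dist x z ≤ dist y x := by
        have := lt_of_le_of_ne hB (Ne.symm h)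
        linarith
      simp only [this, if_false]
      simpa using hβ1
  · ext p
    constructor
    · rintro ⟨s, hs, rfl⟩
      by_cases h : s ≤ dist y x
      · simp only [h, if_true]
        exact Or.inl ⟨s, ⟨hs.1, h⟩, rfl⟩
      · simp only [h, if_false]
        exact Or.inr ⟨_, ⟨by linarith, by linarith [hs.2]⟩, rfl⟩
    · rintro (⟨s, hs, rfl⟩ | ⟨s, hs, rfl⟩)
      · exact ⟨s, ⟨hs.1, by linarith [hs.2]⟩, by simp [hs.2]⟩
      · refine ⟨s + dist y x, ⟨by linarith [hs.1], by linarith [hs.2]⟩, ?_⟩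
        by_cases h : s = 0
        · subst h
          simp [hα1, hβ0]
        · have : 0 < s := lt_of_le_of_ne hs.1 (Ne.symm h)
          simp [this]

theorem IsGeodesicSpace.exists_path (hX : IsGeodesicSpace X) (x y : X) :
    ∃ γ : ℝ → X, γ 0 = x ∧ γ (dist x y) = y ∧ IsometricOnIcc γ (dist x y) := by
  obtain ⟨S, γ, h0, h1, hγ, -⟩ := hX x y
  exact ⟨γ, h0, h1, hγ⟩

/-- The final part of an isometric path is a geodesic segment. -/
theorem IsometricOnIcc.isGeodesicSegment_tail {γ : ℝ → X} {L a : ℝ} (h : IsometricOnIcc γ L)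
    (ha : 0 ≤ a) (haL : a ≤ L) :
    IsGeodesicSegment (γ '' Set.Icc a L) (γ a) (γ L) := by
  rw [IsGeodesicSegment, h.dist_of_le ha haL le_rfl]
  refine ⟨fun s => γ (s + a), by simp, by simp, ?_, ?_⟩
  · intro s hs t ht
    rw [h (s + a) ⟨by linarith [hs.1], by linarith [hs.2]⟩ (t + a)
      ⟨by linarith [ht.1], by linarith [ht.2]⟩]
    congr 1
    ring
  · ext p
    constructor
    · rintro ⟨s, hs, rfl⟩
      exact ⟨s + a, ⟨by linarith [hs.1], by linarith [hs.2]⟩, rfl⟩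
    · rintro ⟨s, hs, rfl⟩
      exact ⟨s - a, ⟨by linarith [hs.1], by linarith [hs.2]⟩, by simp⟩

end Geodesics

/-! ### From trees to balls -/

section TreeToBalls

variable {X : Type*} [MetricSpace X]

/-- In an `ℝ`-tree, geodesics from `x` to `y` and to `z` branch at a point of a geodesic
from `y` to `z`. -/
theorem IsRTree.exists_branch_point (hT : IsRTree X) {α β : ℝ → X} {A B : ℝ}
    (hα : IsometricOnIcc α A) (hβ : IsometricOnIcc β B) (hA : 0 ≤ A) (hB : 0 ≤ B)
    (h0 : α 0 = β 0) :
    ∃ a, 0 ≤ a ∧ a ≤ A ∧ a ≤ B ∧ α a = β a ∧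
      dist (α A) (β B) = (A - a) + (B - a) := by
  -- The branch parameter is the last time of agreement. A common point of the two tails has the
  -- same distance from the start, hence the same parameter on both.
  let K : Set ℝ := {s | s ∈ Set.Icc 0 (min A B) ∧ dist (α s) (β s) = 0}
  have hcont : ContinuousOn (fun s => dist (α s) (β s)) (Set.Icc 0 (min A B)) :=
    continuous_dist.comp_continuousOn ((hα.mono (min_le_left A B)).continuousOn.prodMk
      (hβ.mono (min_le_right A B)).continuousOn)
  have hK : IsCompact K := by
    have hcl : IsClosed (Set.Icc 0 (min A B) ∩ (fun s => dist (α s) (β s)) ⁻¹' {0}) :=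
      hcont.preimage_isClosed_of_isClosed isClosed_Icc isClosed_singleton
    exact isCompact_Icc.of_isClosed_subset hcl Set.inter_subset_left
  obtain ⟨a, ⟨⟨ha0, ha⟩, haeq⟩, hamax⟩ :=
    hK.exists_isGreatest ⟨0, ⟨le_rfl, le_min hA hB⟩, by simp [h0]⟩
  have haA := ha.trans (min_le_left _ _)
  have haB := ha.trans (min_le_right _ _)
  rw [dist_eq_zero] at haeq
  refine ⟨a, ha0, haA, haB, haeq, ?_⟩
  have hS := (hα.isGeodesicSegment_tail ha0 haA).symm
  have hT' := hβ.isGeodesicSegment_tail ha0 haB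
  rw [← haeq] at hT'
  have hint : α '' Set.Icc a A ∩ β '' Set.Icc a B = {α a} := by
    ext p
    simp only [Set.mem_singleton_iff]
    constructor
    · rintro ⟨⟨s, hs, rfl⟩, t, ht, hts⟩
      have e1 := hα.dist_of_le le_rfl (ha0.trans hs.1) hs.2
      have e2 := hβ.dist_of_le le_rfl (ha0.trans ht.1) ht.2
      rw [hts, ← h0, e1] at e2
      have hst : s = t := by linarith
      subst hst
      have : s ≤ a := hamax ⟨⟨ha0.trans hs.1, le_min hs.2 ht.2⟩, by rw [hts, dist_self]⟩
      rw [le_antisymm this hs.1]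
    · rintro rfl
      exact ⟨⟨a, ⟨le_rfl, haA⟩, rfl⟩, a, ⟨le_rfl, haB⟩, haeq.symm⟩
  have hU := hT.union_segment _ _ _ _ _ hS hT' hint
  have := hU.dist_add_dist (p := α a) (Or.inl ⟨a, ⟨le_rfl, haA⟩, rfl⟩)
  rw [dist_comm (α A), hα.dist_of_le ha0 haA le_rfl, haeq, hβ.dist_of_le ha0 haB le_rfl] at this
  exact this.symm

theorem IsRTree.isBall_inter (hX : IsGeodesicSpace X) (hT : IsRTree X) (x y : X) (s t : ℝ)
    (hs : 0 ≤ s) (ht : 0 ≤ t) :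
    Metric.closedBall x s ∩ Metric.closedBall y t = ∅ ∨
      IsBall (Metric.closedBall x s ∩ Metric.closedBall y t) := by
  rcases lt_or_ge (s + t) (dist x y) with h | h
  · exact Or.inl (Metric.closedBall_disjoint_closedBall h).inter_eq
  right
  rcases le_total (t + dist x y) s with h1 | h1
  · refine ⟨y, t, ht, Set.inter_eq_right.2 (Metric.closedBall_subset_closedBall' ?_)⟩
    rwa [dist_comm]
  rcases le_total (s + dist x y) t with h2 | h2
  · exact ⟨x, s, hs, Set.inter_eq_left.2 (Metric.closedBall_subset_closedBall' h2)⟩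
  obtain ⟨α, hα0, hα1, hα⟩ := hX.exists_path x y
  set d := dist x y with hd
  have hk0 : 0 ≤ (d + s - t) / 2 := by linarith
  have hkd : (d + s - t) / 2 ≤ d := by linarith
  -- With k = (d + s - t) / 2, the radius is s - k = t - (d - k).
  refine ⟨α ((d + s - t) / 2), (s + t - d) / 2, by linarith, Set.Subset.antisymm ?_ ?_⟩
  · rintro z ⟨hzx, hzy⟩
    rw [Metric.mem_closedBall, dist_comm] at hzx hzy ⊢
    obtain ⟨β, hβ0, hβ1, hβ⟩ := hX.exists_path x z
    obtain ⟨a, ha0, haA, haB, hab, hdist⟩ := hT.exists_branch_point hα hβ (by positivity)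
      dist_nonneg (hα0.trans hβ0.symm)
    rw [hα1, hβ1] at hdist
    have htri := dist_triangle (α ((d + s - t) / 2)) (α a) z
    have hpz : dist (α a) z = dist x z - a := by
      have := hβ.dist_of_le ha0 haB le_rfl
      rwa [hβ1, ← hab] at this
    -- If [x,z] branches off beyond the centre, `dist x z ≤ s` gives the bound; otherwise `dist y z
    -- ≤ t` does.
    rcases le_total ((d + s - t) / 2) a with hka | hka
    · have := hα.dist_of_le hk0 hka haA
      linarith
    · have := hα.dist_of_le ha0 hka hkd
      rw [dist_comm] at this
      linarith
  · refine Set.subset_inter (Metric.closedBall_subset_closedBall' ?_)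
      (Metric.closedBall_subset_closedBall' ?_)
    · have := hα.dist_of_le le_rfl hk0 hkd
      rw [hα0, dist_comm] at this
      linarith
    · have := hα.dist_of_le hk0 hkd le_rfl
      rw [hα1] at this
      linarith

end TreeToBalls

/-! ### From eccentricity to trees -/

section BallsToTree

variable {X : Type*} [MetricSpace X]

theorem HasEccentricityLE.mono {S : Set X} {δ ε : ℝ≥0} (h : HasEccentricityLE S δ)
    (hδ : δ ≤ ε) : HasEccentricityLE S ε := by
  rcases h with h | ⟨R, c, c', hR, h1, h2⟩
  · exact Or.inl h
  · exact Or.inr ⟨R, c, c', hR, h1, h2.trans (Metric.closedBall_subset_closedBall (by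
      have : (δ : ℝ) ≤ ε := hδ
      linarith))⟩

theorem HasEccentricityLE.eccentricity_eq_zero {S : Set X} (h : HasEccentricityLE S 0) :
    eccentricity S = 0 :=
  le_antisymm (iInf₂_le_of_le 0 h (by simp)) bot_le

theorem hasEccentricityLE_of_eccentricity_eq_zero {S : Set X} (h : eccentricity S = 0) {ε : ℝ≥0}
    (hε : 0 < ε) : HasEccentricityLE S ε := by
  have hlt : eccentricity S < ε := by
    rw [h]
    exact_mod_cast hε
  simp only [eccentricity, iInf_lt_iff] at hlt
  obtain ⟨δ, hδ, hlt⟩ := hlt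
  exact hδ.mono (by exact_mod_cast hlt.le)

/-- If intersections of balls have eccentricity `0`, they are small when the balls barely
overlap. -/
theorem IsGeodesicSpace.hasThinBallIntersections (hX : IsGeodesicSpace X)
    (h : ∀ (x y : X) (s t : ℝ), 0 ≤ s → 0 ≤ t →
      eccentricity (Metric.closedBall x s ∩ Metric.closedBall y t) = 0) :
    HasThinBallIntersections X := by
  intro x y z w s t hxz hxw hyz hyw
  -- Here 2t already suffices. In the other case y lies outside B(x,s), hence outside the inner
  -- ball.
  rcases le_or_gt (dist x y) s with hs | hs
  · linarith [dist_triangle_left z w y]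
  rcases le_or_gt (dist x y) t with ht | ht
  · linarith [dist_triangle_left z w x]
  refine le_of_forall_pos_le_add fun ε hε => ?_
  have hecc := hasEccentricityLE_of_eccentricity_eq_zero
    (h x y s t (dist_nonneg.trans hxz) (dist_nonneg.trans hyz))
    (ε := (ε / 2).toNNReal) (Real.toNNReal_pos.2 (half_pos hε))
  have hz : z ∈ Metric.closedBall x s ∩ Metric.closedBall y t := by
    simp only [Set.mem_inter_iff, Metric.mem_closedBall, dist_comm z]
    exact ⟨hxz, hyz⟩
  have hw : w ∈ Metric.closedBall x s ∩ Metric.closedBall y t := by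
    simp only [Set.mem_inter_iff, Metric.mem_closedBall, dist_comm w]
    exact ⟨hxw, hyw⟩
  rcases hecc with he | ⟨R, c, c', hR, hc, hc'⟩
  · rw [he] at hz
    exact hz.elim
  rw [Real.coe_toNNReal _ (half_pos hε).le] at hc'
  have hRc : R < dist c y := by
    by_contra! hle
    have := (hc (show y ∈ Metric.closedBall c R by rwa [Metric.mem_closedBall, dist_comm])).1
    rw [Metric.mem_closedBall, dist_comm] at this
    linarith
  have hct : dist c y ≤ t := (hc (Metric.mem_closedBall_self hR)).2
  -- Moving from c by R towards y stays within s of x and ends within t - R of y, so R ≤ s + t -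
  -- d(x,y).
  obtain ⟨γ, h0, h1, hγ⟩ := hX.exists_path c y
  have e1 := hγ.dist_of_le le_rfl hR hRc.le
  have e2 := hγ.dist_of_le hR hRc.le le_rfl
  rw [h0] at e1
  rw [h1] at e2
  have hp : dist (γ R) x ≤ s :=
    (hc (show γ R ∈ Metric.closedBall c R by
      rw [Metric.mem_closedBall, dist_comm]; linarith)).1
  have hxy := dist_triangle_left x y (γ R)
  have b1 : dist z c' ≤ R + ε / 2 := hc' hz
  have b2 : dist w c' ≤ R + ε / 2 := hc' hw
  linarith [dist_triangle_right z w c']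

/-- The defect `dist (α i) (β k) - (k - i)`. -/
def pathDefect (α β : ℝ → X) (i k : ℝ) : ℝ := dist (α i) (β k) - (k - i)

/-! ### Growth of the defect between two geodesics -/

section PathDefect

variable {α β : ℝ → X} {L : ℝ}

theorem pathDefect_mono_left (hα : IsometricOnIcc α L) {i i' : ℝ} (k : ℝ) (hi : 0 ≤ i)
    (h : i ≤ i') (hi' : i' ≤ L) : pathDefect α β i k ≤ pathDefect α β i' k := by
  have := hα.dist_of_le hi h hi'
  simp only [pathDefect]
  linarith [dist_triangle (α i) (α i') (β k)]

theorem pathDefect_anti_right (hβ : IsometricOnIcc β L) (i : ℝ) {k k' : ℝ} (hk : 0 ≤ k)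
    (h : k ≤ k') (hk' : k' ≤ L) : pathDefect α β i k' ≤ pathDefect α β i k := by
  have := hβ.dist_of_le hk h hk'
  simp only [pathDefect]
  linarith [dist_triangle (α i) (β k) (β k')]

theorem pathDefect_nonneg (hα : IsometricOnIcc α L) (hβ : IsometricOnIcc β L) (h0 : α 0 = β 0)
    {i k : ℝ} (hi : 0 ≤ i) (hiL : i ≤ L) (hk : 0 ≤ k) (hkL : k ≤ L) :
    0 ≤ pathDefect α β i k := by
  have e1 := hα.dist_of_le le_rfl hi hiL
  have e2 := hβ.dist_of_le le_rfl hk hkL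
  rw [← h0] at e2
  simp only [pathDefect]
  linarith [dist_triangle (α 0) (α i) (β k)]

/-- Both points at time s lie in balls about the common start and `β b` whose overlap is exactly the
defect. -/
theorem pathDefect_self_le (H : HasThinBallIntersections X) (hα : IsometricOnIcc α L)
    (hβ : IsometricOnIcc β L) (h0 : α 0 = β 0) {s b : ℝ} (hs : 0 ≤ s) (hsb : s ≤ b)
    (hb : b ≤ L) : pathDefect α β s s ≤ 2 * pathDefect α β s b := by
  have hnn := pathDefect_nonneg hα hβ h0 hs (hsb.trans hb) (hs.trans hsb) hb
  have e1 := hα.dist_of_le le_rfl hs (hsb.trans hb)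
  have e2 := hβ.dist_of_le le_rfl hs (hsb.trans hb)
  have e3 := hβ.dist_of_le hs hsb hb
  have e4 := hβ.dist_of_le le_rfl (hs.trans hsb) hb
  rw [dist_comm] at e3
  have := H (α 0) (β b) (α s) (β s) s (b - s + pathDefect α β s b) (by linarith)
    (by rw [h0]; linarith) (by rw [dist_comm]; simp only [pathDefect]; linarith) (by linarith)
  rw [h0, e4] at this
  simp only [pathDefect] at this ⊢
  linarith

/-- Either the defect drops or it grows along the first path. -/
theorem pathDefect_dichotomy (H : HasThinBallIntersections X) (hα : IsometricOnIcc α L)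
    (hβ : IsometricOnIcc β L) (h0 : α 0 = β 0) {a j b : ℝ} (ha : 0 ≤ a) (haj : a ≤ j)
    (hj : j ≤ L) (hjb : j + pathDefect α β a j ≤ b) (hb : b ≤ L) :
    2 * pathDefect α β a b ≤ pathDefect α β a j ∨
      2 * pathDefect α β a b + pathDefect α β a j ≤
        2 * pathDefect α β (j + pathDefect α β a j) b := by
  have hf := pathDefect_nonneg hα hβ h0 ha (haj.trans hj) (ha.trans haj) hj
  have hfd : dist (α a) (β j) = pathDefect α β a j + (j - a) := by simp only [pathDefect]; ring
  generalize pathDefect α β a j = f at hf hfd hjb ⊢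
  have h1 := hα.dist_of_le ha (show a ≤ j + f by linarith) (hjb.trans hb)
  have h2 := hβ.dist_of_le (ha.trans haj) (show j ≤ b by linarith) hb
  have h3 := hα.dist_of_le le_rfl (show 0 ≤ j + f by linarith) (hjb.trans hb)
  have h4 := hβ.dist_of_le le_rfl (ha.trans haj) hj
  rw [← h0] at h4
  have h5 := dist_triangle_right (α 0) (α (j + f)) (β j)
  -- The points `α (j + f)` and `β j` are at least f apart, by their distances from the start. The
  -- second radius is the least one reaching both, and its maximum yields the two alternatives.
  have key := H (α a) (β b) (α (j + f)) (β j) (j + f - a)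
    (b - j + max 0 (pathDefect α β (j + f) b - f)) h1.le (by linarith)
    (by
      have := le_max_right 0 (pathDefect α β (j + f) b - f)
      rw [dist_comm]
      simp only [pathDefect] at this ⊢
      linarith)
    (by
      have := le_max_left 0 (pathDefect α β (j + f) b - f)
      rw [dist_comm]
      linarith)
  have h6 : dist (α a) (β b) = pathDefect α β a b + (b - a) := by simp only [pathDefect]; ring
  have h7 := dist_triangle (α 0) (β j) (α (j + f))
  rw [dist_comm (β j)] at h7
  rcases max_cases 0 (pathDefect α β (j + f) b - f) with ⟨h, -⟩ | ⟨h, -⟩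
  · left
    linarith
  · right
    linarith

/-- Write g for the defect at (a, L) and f for that at (a, a + 2g), so g ≤ f ≤ 2g. If f < 2g, the
dichotomy at j = a + 2g must give growth. If f = 2g, the defect stays at 2g from time a to a + 2g,
and the dichotomy at j = a gives growth. -/
theorem pathDefect_growth (H : HasThinBallIntersections X) (hα : IsometricOnIcc α L)
    (hβ : IsometricOnIcc β L) (h0 : α 0 = β 0) {a : ℝ} (ha : 0 ≤ a)
    (hg : 0 < pathDefect α β a L) (haL : a + 4 * pathDefect α β a L ≤ L) :
    3 * pathDefect α β a L ≤ 2 * pathDefect α β (a + 4 * pathDefect α β a L) L := by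
  have hself := pathDefect_self_le H hα hβ h0 ha (by linarith : a ≤ L) le_rfl
  have hmono : ∀ i, 0 ≤ i → i ≤ a + 4 * pathDefect α β a L →
      pathDefect α β i L ≤ pathDefect α β (a + 4 * pathDefect α β a L) L :=
    fun i h h' => pathDefect_mono_left hα L h h' haL
  generalize hgg : pathDefect α β a L = g at *
  have hj : a + 2 * g ≤ L := by linarith
  have hfg := pathDefect_anti_right (α := α) hβ a (by linarith : 0 ≤ a + 2 * g) hj le_rfl
  have hfD := pathDefect_anti_right (α := α) hβ a ha (by linarith : a ≤ a + 2 * g) hj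
  rcases lt_or_ge (pathDefect α β a (a + 2 * g)) (2 * g) with hlt | hge
  · have hi := hmono (a + 2 * g + pathDefect α β a (a + 2 * g)) (by linarith) (by linarith)
    rcases pathDefect_dichotomy H hα hβ h0 ha (by linarith : a ≤ a + 2 * g) hj
      (by linarith) le_rfl with h | h <;> linarith
  · have hD : pathDefect α β a a = 2 * g := le_antisymm hself (hge.trans hfD)
    have hi := hmono (a + 2 * g) (by linarith) (by linarith)
    have hjj := pathDefect_self_le H hα hβ h0 (by linarith : 0 ≤ a + 2 * g) hj le_rfl
    have := pathDefect_dichotomy H hα hβ h0 ha le_rfl (by linarith : a ≤ L)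
      (by rw [hD]) hj
    rw [hD] at this
    rcases this with h | h <;> linarith

/-- Steps of length 4g multiply g by at least 3/2, and 4g - 8 · (3/2)g = -8g closes the induction.
The last step overshoots L, where 4g ≤ 12g - 8g. -/
theorem sub_le_pathDefect (H : HasThinBallIntersections X) (hα : IsometricOnIcc α L)
    (hβ : IsometricOnIcc β L) (h0 : α 0 = β 0) {a : ℝ} (ha : 0 ≤ a) (haL : a ≤ L)
    (hg : 0 < pathDefect α β a L) :
    L - a ≤ 12 * pathDefect α β L L - 8 * pathDefect α β a L := by
  -- A fixed lower bound for the defect bounds the number of steps.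
  obtain ⟨μ, hμ, hμg⟩ : ∃ μ, 0 < μ ∧ μ ≤ pathDefect α β a L := ⟨_, hg, le_rfl⟩
  obtain ⟨n, hn⟩ := exists_nat_ge ((L - a) / μ)
  rw [div_le_iff₀ hμ] at hn
  clear hg
  induction n generalizing a with
  | zero =>
    have := pathDefect_mono_left (β := β) hα L ha haL le_rfl
    simp only [Nat.cast_zero, zero_mul] at hn
    linarith
  | succ n ih =>
    have hmono := pathDefect_mono_left (β := β) hα L ha haL le_rfl
    rcases lt_or_ge L (a + 4 * pathDefect α β a L) with h | h
    · linarith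
    · have hgr := pathDefect_growth H hα hβ h0 ha (hμ.trans_le hμg) h
      push_cast at hn
      have := ih (a := a + 4 * pathDefect α β a L) (by linarith) h (by linarith) (by linarith)
      linarith

end PathDefect

/-- Geodesics from a common point to nearby points coincide away from their ends. -/
theorem HasThinBallIntersections.eq_of_dist_lt (H : HasThinBallIntersections X) {α β : ℝ → X}
    {A B : ℝ} (hα : IsometricOnIcc α A) (hβ : IsometricOnIcc β B) (h0 : α 0 = β 0) {s : ℝ}
    (hs : 0 ≤ s) (hA : s + 24 * dist (α A) (β B) < A) (hB : s + 24 * dist (α A) (β B) < B) :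
    α s = β s := by
  wlog hAB : A ≤ B generalizing α β A B
  · rw [dist_comm] at hA hB
    exact (this hβ hα h0.symm hB hA (le_of_not_ge hAB)).symm
  have hd : 0 ≤ dist (α A) (β B) := dist_nonneg
  have hβ' := hβ.mono hAB
  by_contra hne
  have hself := pathDefect_self_le H hα hβ' h0 hs (by linarith : s ≤ A) le_rfl
  have hpos : 0 < pathDefect α β s s := by simpa [pathDefect] using dist_pos.2 hne
  -- The defect at (A, A) is at most twice the distance of the ends, as B - A is at most that
  -- distance; hence 24 = 2 · 12.
  have hle := sub_le_pathDefect H hα hβ' h0 hs (by linarith : s ≤ A) (by linarith)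
  have e1 := hα.dist_of_le le_rfl (by linarith : 0 ≤ A) le_rfl
  have e2 := hβ.dist_of_le le_rfl (by linarith : 0 ≤ B) le_rfl
  have e3 := hβ.dist_of_le (by linarith : 0 ≤ A) hAB le_rfl
  rw [← h0] at e2
  have t1 := dist_triangle (α 0) (α A) (β B)
  have t2 := dist_triangle_right (α A) (β A) (β B)
  have : pathDefect α β A A = dist (α A) (β A) := by simp [pathDefect]
  linarith

theorem HasThinBallIntersections.eqOn (H : HasThinBallIntersections X) {α β : ℝ → X}
    {L : ℝ} (hα : IsometricOnIcc α L) (hβ : IsometricOnIcc β L) (h0 : α 0 = β 0)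
    (h1 : α L = β L) : Set.EqOn α β (Set.Icc 0 L) := by
  intro s hs
  rcases hs.2.eq_or_lt with rfl | h
  · exact h1
  · exact H.eq_of_dist_lt hα hβ h0 hs.1 (by simpa [h1] using h) (by simpa [h1] using h)

/-- The point of a geodesic `σ` nearest to `x` lies on the geodesics from `x` to the ends
of `σ`. -/
theorem HasThinBallIntersections.exists_branch_point (hX : IsGeodesicSpace X)
    (H : HasThinBallIntersections X) {x : X} {σ α β : ℝ → X} {L : ℝ} (hL : 0 ≤ L)
    (hσ : IsometricOnIcc σ L) (hα : IsometricOnIcc α (dist x (σ 0)))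
    (hβ : IsometricOnIcc β (dist x (σ L))) (hα0 : α 0 = x) (hβ0 : β 0 = x)
    (hα1 : α (dist x (σ 0)) = σ 0) (hβ1 : β (dist x (σ L)) = σ L) :
    ∃ a ∈ Set.Icc 0 (dist x (σ 0)), ∃ b ∈ Set.Icc 0 (dist x (σ L)), ∃ c ∈ Set.Icc 0 L,
      α a = σ c ∧ β b = σ c := by
  obtain ⟨c, hc, hmin⟩ := isCompact_Icc.exists_isMinOn (Set.nonempty_Icc.2 hL)
    ((continuous_const.dist continuous_id : Continuous fun p => dist x p).comp_continuousOn
      hσ.continuousOn)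
  have hmin' : ∀ t ∈ Set.Icc 0 L, dist x (σ c) ≤ dist x (σ t) := fun t ht => hmin ht
  have h0L : (0 : ℝ) ∈ Set.Icc 0 L := ⟨le_rfl, hL⟩
  have hLL : L ∈ Set.Icc 0 L := ⟨hL, le_rfl⟩
  choose γ hγ0 hγ1 hγ using fun t => hX.exists_path x (σ t)
  set h := dist x (σ c) with hh
  -- Below height h, geodesics from x to nearby points of σ agree, so their point at time s is
  -- locally constant in t.
  have hconst : ∀ s, 0 ≤ s → s < h → ∀ t ∈ Set.Icc 0 L, γ t s = γ 0 s := by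
    intro s hs hsh
    refine eq_of_locally_eq (F := fun t => γ t s) (η := (h - s) / 24) (by linarith) ?_
    intro t ht t' ht' htt
    have hd := hσ t ht t' ht'
    have m1 := hmin' t ht
    have m2 := hmin' t' ht'
    refine H.eq_of_dist_lt (hγ t) (hγ t') ((hγ0 t).trans (hγ0 t').symm) hs ?_ ?_ <;>
    · rw [hγ1, hγ1, hd]
      linarith
  -- Letting s tend to h from below extends the agreement to time h, where the geodesic to `σ c`
  -- ends.
  have hend : ∀ t ∈ Set.Icc 0 L, γ t h = σ c := by
    intro t ht
    have hhn : 0 ≤ h := dist_nonneg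
    refine eq_of_forall_dist_le fun ε hε => ?_
    rcases hhn.eq_or_lt with h0 | hpos
    · have : x = σ c := dist_eq_zero.1 h0.symm
      rw [← h0, hγ0, ← this, dist_self]
      exact hε.le
    · have hm : max 0 (h - ε / 2) < h := max_lt hpos (by linarith)
      have hm0 := le_max_left 0 (h - ε / 2)
      have hm1 := le_max_right 0 (h - ε / 2)
      have e1 := (hγ t).dist_of_le hm0 hm.le (hmin' t ht)
      have e2 := (hγ c).dist_of_le hm0 hm.le le_rfl
      rw [hconst _ hm0 hm t ht] at e1
      rw [hconst _ hm0 hm c hc, hγ1] at e2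
      linarith [dist_triangle_left (γ t h) (σ c) (γ 0 (max 0 (h - ε / 2)))]
  have hα' := H.eqOn hα (hγ 0) (hα0.trans (hγ0 0).symm) (hα1.trans (hγ1 0).symm)
    ⟨dist_nonneg, hmin' 0 h0L⟩
  have hβ' := H.eqOn hβ (hγ L) (hβ0.trans (hγ0 L).symm) (hβ1.trans (hγ1 L).symm)
    ⟨dist_nonneg, hmin' L hLL⟩
  exact ⟨h, ⟨dist_nonneg, hmin' 0 h0L⟩, h, ⟨dist_nonneg, hmin' L hLL⟩, c, hc,
    hα'.trans (hend 0 h0L), hβ'.trans (hend L hLL)⟩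

theorem HasThinBallIntersections.isRTree (hX : IsGeodesicSpace X)
    (H : HasThinBallIntersections X) : IsRTree X where
  existsUnique_segment x y := by
    obtain ⟨S, hS⟩ := hX x y
    refine ⟨S, hS, fun T hT => ?_⟩
    obtain ⟨α, hα0, hα1, hα, rfl⟩ := hS
    obtain ⟨β, hβ0, hβ1, hβ, rfl⟩ := hT
    exact (H.eqOn hβ hα (hβ0.trans hα0.symm) (hβ1.trans hα1.symm)).image_eq
  union_segment x y z S T hS hT hST := by
    refine hS.union hT ?_
    obtain ⟨σ, hσ0, hσ1, hσ⟩ := hX.exists_path y z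
    obtain ⟨α, hα0, hα1, hα, hαS⟩ := hS.symm
    obtain ⟨β, hβ0, hβ1, hβ, hβT⟩ := hT
    obtain ⟨a, ha, b, hb, c, hc, hac, hbc⟩ := H.exists_branch_point hX dist_nonneg hσ
      (by rwa [hσ0]) (by rwa [hσ1]) hα0 hβ0 (by rwa [hσ0]) (by rwa [hσ1])
    rw [hσ0] at ha
    rw [hσ1] at hb
    have hmem : σ c ∈ S ∩ T := ⟨by rw [← hαS]; exact ⟨a, ha, hac⟩, by
      rw [← hβT]; exact ⟨b, hb, hbc⟩⟩
    rw [hST, Set.mem_singleton_iff] at hmem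
    have e1 := hσ.dist_of_le le_rfl hc.1 hc.2
    have e2 := hσ.dist_of_le hc.1 hc.2 le_rfl
    rw [hσ0, hmem] at e1
    rw [hσ1, hmem] at e2
    linarith

theorem IsBall.hasEccentricityLE_zero {S : Set X} (h : IsBall S) : HasEccentricityLE S 0 := by
  obtain ⟨c, r, hr, rfl⟩ := h
  exact Or.inr ⟨r, c, c, hr, subset_rfl, by simp⟩

end BallsToTree

theorem corollary2 {X : Type*} [MetricSpace X] (hX : IsGeodesicSpace X) :
    (IsRTree X ↔ ∀ (x y : X) (s t : ℝ), 0 ≤ s → 0 ≤ t →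
      Metric.closedBall x s ∩ Metric.closedBall y t = ∅ ∨
        IsBall (Metric.closedBall x s ∩ Metric.closedBall y t)) ∧
    (IsRTree X ↔ ∀ (x y : X) (s t : ℝ), 0 ≤ s → 0 ≤ t →
      HasEccentricityLE (Metric.closedBall x s ∩ Metric.closedBall y t) 0) ∧
    (IsRTree X ↔ ∀ (x y : X) (s t : ℝ), 0 ≤ s → 0 ≤ t →
      eccentricity (Metric.closedBall x s ∩ Metric.closedBall y t) = 0) := by
  have h12 := IsRTree.isBall_inter hX
  have h23 : ∀ S : Set X, S = ∅ ∨ IsBall S → HasEccentricityLE S 0 := fun S hS =>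
    hS.elim Or.inl IsBall.hasEccentricityLE_zero
  have h34 : ∀ S : Set X, HasEccentricityLE S 0 → eccentricity S = 0 := fun S =>
    HasEccentricityLE.eccentricity_eq_zero
  have h41 := fun h => (hX.hasThinBallIntersections h).isRTree hX
  exact ⟨⟨h12, fun h => h41 fun x y s t hs ht => h34 _ (h23 _ (h x y s t hs ht))⟩,
    ⟨fun h x y s t hs ht => h23 _ (h12 h x y s t hs ht),
      fun h => h41 fun x y s t hs ht => h34 _ (h x y s t hs ht)⟩,
    ⟨fun h x y s t hs ht => h34 _ (h23 _ (h12 h x y s t hs ht)), h41⟩⟩
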